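/- Let $X$ be a real Banach space that is uniformly convex and uniformly smooth (the latter meaning $\rho_X(t)/t\to 0$ as $t\downarrow 0$, where $\rho_X(t)=\sup\{\tfrac12(\|x+y\|+\|x-y\|)-1:\|x\|=1,\|y\|=t\}$), and let $C\subseteq X$ be nonempty, closed and convex. Let $J_X:X\to X^*$ be the normalized duality map, given by $\langle J_Xx,x\rangle=\|J_Xx\|\,\|x\|=\|x\|^2=\|J_Xx\|^2$, and let $J_{X^*}:X^*\to X$ be the normalized duality map of $X^*$ (with $X^{**}$ identified with $X$), so that $\langle\psi,J_{X^*}\psi\rangle=\|\psi\|\,\|J_{X^*}\psi\|=\|\psi\|^2=\|J_{X^*}\psi\|^2$. Let $\pi_C:X^*\to C$ be the generalized projection, where $\pi_C(\psi)$ is the point of $C$ that minimizes $V(\psi,z)=\|\psi\|^2-2\langle\psi,z\rangle+\|z\|^2$ over $z\in C$, and let $\Pi_C=\pi_C\circ J_X:X\to C$ be the generalized metric projection. Then $J_X$, $J_{X^*}$ and $\pi_C$ are well defined and single-valued, and for every $y\in C$ the inverse images $\Pi_C^{-1}(y)=\{u\in X:\Pi_C(u)=y\}$ and $\pi_C^{-1}(y)=\{\phi\in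 X^*:\pi_C(\phi)=y\}$ satisfy $$\Pi_C^{-1}(y)=J_{X^*}\bigl(\pi_C^{-1}(y)\bigr).$$ In general, $\Pi_C^{-1}(y)$ is neither a convex set nor a cone. Explicitly, let $X=\mathbb{R}^3$ with the norm $\|z\|_3=(|z_1|^3+|z_2|^3+|z_3|^3)^{1/3}$, which is a uniformly convex and uniformly smooth Banach space, let $y=\bigl(3^{-1/3},3^{-1/3},3^{-1/3}\bigr)$, and let $C=\{ty:0\le t\le 1\}$, a nonempty, closed and convex set containing $y$. Then there is $x\neq y$ with $\Pi_C(x)=y$; the set $K=\Pi_C^{-1}(y)$ is not convex; and $K$ is not a cone with vertex at any point, that is, there is no $p\in X$ such that $p+t(u-p)\in K$ for all $u\in K$ and all $t\ge 0$. -/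

import Mathlib

open scoped Topology ENNReal

/-- The modulus of smoothness
`ρ_X(t) = sup {(‖x + y‖ + ‖x - y‖) / 2 - 1 : ‖x‖ = 1, ‖y‖ = t}`. For `t ≥ 0` the set is bounded
above by `t`; it is empty only for a one-point space. -/
noncomputable def modulusOfSmoothness (X : Type*) [NormedAddCommGroup X] (t : ℝ) : ℝ :=
  sSup {r : ℝ | ∃ x y : X, ‖x‖ = 1 ∧ ‖y‖ = t ∧ r = (‖x + y‖ + ‖x - y‖) / 2 - 1}

/-- A normed space is uniformly smooth if `ρ_X(t) / t → 0` as `t ↓ 0`. -/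
class UniformSmoothSpace (X : Type*) [NormedAddCommGroup X] : Prop where
  tendsto_modulus :
    Filter.Tendsto (fun t : ℝ => modulusOfSmoothness X t / t) (𝓝[>] (0 : ℝ)) (𝓝 0)

section Projections

variable {X : Type*} [NormedAddCommGroup X] [NormedSpace ℝ X]

/-- `f ∈ X*` is a value at `x` of the normalized duality map:
`⟨f, x⟩ = ‖f‖ ‖x‖ = ‖x‖² = ‖f‖²`. -/
def IsNormalizedDual (x : X) (f : StrongDual ℝ X) : Prop :=
  f x = ‖f‖ * ‖x‖ ∧ ‖f‖ * ‖x‖ = ‖x‖ ^ 2 ∧ ‖x‖ ^ 2 = ‖f‖ ^ 2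

/-- The normalized duality map `J_X : X → X*`. -/
noncomputable def dualityMap (x : X) : StrongDual ℝ X :=
  Classical.epsilon fun f => IsNormalizedDual x f

/-- `x ∈ X` is a value at `ψ ∈ X*` of the normalized duality map of `X*`, where `X` is
regarded as a subset of `X**` through the canonical embedding. -/
def IsPredualNormalizedDual (ψ : StrongDual ℝ X) (x : X) : Prop :=
  IsNormalizedDual ψ (NormedSpace.inclusionInDoubleDual ℝ X x)

/-- The normalized duality map `J_{X*} : X* → X` of the dual of a reflexive space `X`
(with the identification `X** = X`). -/
noncomputable def dualityMapDual (ψ : StrongDual ℝ X) : X :=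
  Classical.epsilon fun x => IsPredualNormalizedDual ψ x

/-- The Lyapunov function `V(ψ, x) = ‖ψ‖² - 2⟨ψ, x⟩ + ‖x‖²`. -/
noncomputable def lyapunov (ψ : StrongDual ℝ X) (x : X) : ℝ :=
  ‖ψ‖ ^ 2 - 2 * ψ x + ‖x‖ ^ 2

/-- `y` is a generalized projection of `ψ` on `C`: `y ∈ C` and `V(ψ, y) = inf_{z ∈ C} V(ψ, z)`. -/
def IsGenProj (C : Set X) (ψ : StrongDual ℝ X) (y : X) : Prop :=
  y ∈ C ∧ IsMinOn (lyapunov ψ) C y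

/-- The generalized projection `π_C : X* → C`. -/
noncomputable def genProj (C : Set X) (ψ : StrongDual ℝ X) : X :=
  Classical.epsilon fun y => IsGenProj C ψ y

/-- The generalized metric projection `Π_C = π_C ∘ J_X : X → C`. -/
noncomputable def genMetricProj (C : Set X) (x : X) : X :=
  genProj C (dualityMap x)

/-- `π_C⁻¹(y) ⊆ X*`. -/
def genProjFiber (C : Set X) (y : X) : Set (StrongDual ℝ X) :=
  {φ | genProj C φ = y}

/-- `Π_C⁻¹(y) ⊆ X`. -/
def genMetricProjFiber (C : Set X) (y : X) : Set X :=
  {u | genMetricProj C u = y}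

/-- `K` is a cone with vertex at `p`. -/
def IsConeAt (K : Set X) (p : X) : Prop :=
  ∀ u ∈ K, ∀ t : ℝ, 0 ≤ t → p + t • (u - p) ∈ K

end Projections

instance fact_one_le_three_ennreal : Fact ((1 : ℝ≥0∞) ≤ 3) := ⟨by norm_num⟩

/-- `ℝ³` with the norm `‖z‖₃ = (|z₁|³ + |z₂|³ + |z₃|³)^(1/3)`. -/
abbrev R3 : Type := PiLp 3 (fun _ : Fin 3 => ℝ)

/-- The point `(3^(-1/3), 3^(-1/3), 3^(-1/3))`, of norm one. -/
noncomputable def diagPoint : R3 := WithLp.toLp 3 (fun _ => (3 : ℝ) ^ (-(1 / 3) : ℝ))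

/-- The closed segment `{t y : 0 ≤ t ≤ 1}` with `y` the point above. -/
def diagSegment : Set R3 := {z | ∃ t : ℝ, 0 ≤ t ∧ t ≤ 1 ∧ z = t • diagPoint}

/-! The relation `IsNormalizedDual x f` is symmetric in `x` and `f`, so once `J_X` and `J_{X*}` are
single-valued they are mutually inverse and the fibre formula is formal. Uniform smoothness makes
`J_X` single-valued. Uniform convexity and completeness give a unique minimizer of `V(ψ, ·)` on `C`;
since `V ≥ 0`, with equality exactly on the duality relation, `J_{X*}` is the case `C = X`.

In `ℝ³` with the cubic norm, `J x = (xᵢ|xᵢ|) / ‖x‖`, and a functional projects to the endpoint `y`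
of the segment iff it is at least `1` there. With `Q = ∑ xᵢ|xᵢ|` and `S = ∑ |xᵢ|³` the fibre is
therefore `Q > 0`, `3S ≤ Q³`. A midpoint with `Q < 0` refutes convexity. If the fibre were a cone
with vertex `(p, q, r)`, contracting far points towards the vertex would force `p + q > 9/10`, and
following rays to infinity would force `5p + 3q + 4r ≤ 5`. Summed over cyclic rotations these are
incompatible. -/

theorem le_modulusOfSmoothness {X : Type*} [NormedAddCommGroup X] {t : ℝ}
    {x y : X} (hx : ‖x‖ = 1) (hy : ‖y‖ = t) :
    (‖x + y‖ + ‖x - y‖) / 2 - 1 ≤ modulusOfSmoothness X t := by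
  refine le_csSup ⟨t, ?_⟩ ⟨x, y, hx, hy, rfl⟩
  rintro r ⟨a, b, ha, hb, rfl⟩
  have h1 := norm_add_le a b
  have h2 := norm_sub_le a b
  linarith

/-! ### Duality maps and the generalized projection. -/

section DualityMaps

variable {X : Type*} [NormedAddCommGroup X] [NormedSpace ℝ X]

theorem isNormalizedDual_iff {x : X} {f : StrongDual ℝ X} :
    IsNormalizedDual x f ↔ ‖f‖ = ‖x‖ ∧ f x = ‖x‖ ^ 2 := by
  constructor
  · rintro ⟨h1, h2, h3⟩
    refine ⟨?_, h1.trans h2⟩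
    have := (sq_eq_sq₀ (norm_nonneg x) (norm_nonneg f)).1 h3
    exact this.symm
  · rintro ⟨h1, h2⟩
    refine ⟨?_, ?_, ?_⟩ <;> rw [h1]
    · rw [h2, sq]
    · rw [sq]

theorem isPredualNormalizedDual_iff {x : X} {f : StrongDual ℝ X} :
    IsPredualNormalizedDual f x ↔ IsNormalizedDual x f := by
  have hn : ‖NormedSpace.inclusionInDoubleDual ℝ X x‖ = ‖x‖ :=
    (NormedSpace.inclusionInDoubleDualLi ℝ (E := X)).norm_map x
  rw [IsPredualNormalizedDual, isNormalizedDual_iff, isNormalizedDual_iff, hn,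
    NormedSpace.dual_def]
  constructor
  · rintro ⟨h1, h2⟩
    exact ⟨h1.symm, by rw [h2, h1]⟩
  · rintro ⟨h1, h2⟩
    exact ⟨h1.symm, by rw [h2, h1]⟩

theorem sq_norm_sub_norm_le_lyapunov (ψ : StrongDual ℝ X) (x : X) :
    (‖ψ‖ - ‖x‖) ^ 2 ≤ lyapunov ψ x := by
  have h : ψ x ≤ ‖ψ‖ * ‖x‖ := (le_abs_self _).trans (ψ.le_opNorm x)
  unfold lyapunov
  nlinarith

theorem lyapunov_nonneg (ψ : StrongDual ℝ X) (x : X) : 0 ≤ lyapunov ψ x :=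
  (sq_nonneg _).trans (sq_norm_sub_norm_le_lyapunov ψ x)

theorem lyapunov_eq_zero_iff {ψ : StrongDual ℝ X} {x : X} :
    lyapunov ψ x = 0 ↔ IsNormalizedDual x ψ := by
  rw [isNormalizedDual_iff]
  constructor
  · intro h
    have h1 := sq_norm_sub_norm_le_lyapunov ψ x
    have h2 : ‖ψ‖ = ‖x‖ := by
      rw [h] at h1
      have := pow_eq_zero_iff (two_ne_zero) |>.1 (le_antisymm h1 (sq_nonneg _))
      linarith
    refine ⟨h2, ?_⟩
    rw [lyapunov, h2] at h
    linarith
  · rintro ⟨h1, h2⟩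
    rw [lyapunov, h1, h2]
    ring

theorem continuous_lyapunov (ψ : StrongDual ℝ X) : Continuous (lyapunov ψ) := by
  unfold lyapunov
  fun_prop

/-- The values of the Lyapunov function come arbitrarily close to zero. -/
theorem exists_lyapunov_lt (ψ : StrongDual ℝ X) {ε : ℝ} (hε : 0 < ε) :
    ∃ x, lyapunov ψ x < ε := by
  rcases eq_or_ne ψ 0 with rfl | hψ
  · exact ⟨0, by simpa [lyapunov] using hε⟩
  have hpos : 0 < ‖ψ‖ := norm_pos_iff.2 hψ
  set r := max (‖ψ‖ - ε / (4 * ‖ψ‖)) 0 with hr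
  have hlt : r < ‖ψ‖ := max_lt (by have : 0 < ε / (4 * ‖ψ‖) := by positivity
                                   linarith) hpos
  obtain ⟨x, hx, hxr⟩ := ψ.exists_lt_apply_of_lt_opNorm hlt
  have hr1 : ‖ψ‖ - ε / (4 * ‖ψ‖) ≤ r := le_max_left _ _
  have key : ∀ z : X, ‖z‖ < 1 → r < ψ z → lyapunov ψ (‖ψ‖ • z) < ε := by
    intro z hz hrz
    have h1 : ‖ψ‖ * (‖ψ‖ - ψ z) ≤ ε / 4 := by
      have : ‖ψ‖ - ψ z ≤ ε / (4 * ‖ψ‖) := by linarith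
      calc _ ≤ ‖ψ‖ * (ε / (4 * ‖ψ‖)) := by gcongr
        _ = ε / 4 := by field_simp
    rw [lyapunov, map_smul, norm_smul, norm_norm, smul_eq_mul, mul_pow]
    have h2 : ‖z‖ ^ 2 ≤ 1 := by nlinarith [norm_nonneg z]
    nlinarith [mul_le_mul_of_nonneg_left h2 (sq_nonneg ‖ψ‖)]
  rcases le_total 0 (ψ x) with h | h
  · exact ⟨_, key x hx (by rwa [Real.norm_of_nonneg h] at hxr)⟩
  · exact ⟨_, key (-x) (by rwa [norm_neg]) (by rwa [map_neg, ← Real.norm_of_nonpos h])⟩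

theorem exists_isNormalizedDual (x : X) : ∃ f : StrongDual ℝ X, IsNormalizedDual x f := by
  rcases eq_or_ne x 0 with rfl | hx
  · exact ⟨0, isNormalizedDual_iff.2 (by simp)⟩
  obtain ⟨g, hg, hgx⟩ := exists_dual_vector ℝ x (norm_ne_zero_iff.2 hx)
  refine ⟨‖x‖ • g, isNormalizedDual_iff.2 ⟨by rw [norm_smul, hg, norm_norm, mul_one], ?_⟩⟩
  rw [smul_apply, hgx, smul_eq_mul, sq]
  rfl

/-- Supporting functionals at a point of the unit sphere of a uniformly smooth space agree. -/
theorem eq_of_norm_le_one_of_apply_eq_one [UniformSmoothSpace X] {x : X} (hx : ‖x‖ = 1)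
    {f g : StrongDual ℝ X} (hf : ‖f‖ ≤ 1) (hg : ‖g‖ ≤ 1) (hfx : f x = 1) (hgx : g x = 1) :
    f = g := by
  have key : ∀ y : X, ‖y‖ = 1 → f y - g y ≤ 0 := by
    intro y hy
    have hlim := (UniformSmoothSpace.tendsto_modulus (X := X)).const_mul 2
    rw [mul_zero] at hlim
    refine ge_of_tendsto hlim ?_
    filter_upwards [self_mem_nhdsWithin] with t (ht : 0 < t)
    -- Adding `f (x + t y)` and `g (x - t y)` gives `2 + t (f - g) y ≤ 2 + 2 ρ(t)`, so `(f - g) y ≤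
    -- 2 ρ(t) / t → 0`.
    have h := le_modulusOfSmoothness (t := t) (y := t • y) hx
      (by rw [norm_smul, hy, mul_one, Real.norm_of_nonneg ht.le])
    have h1 : f (x + t • y) ≤ ‖x + t • y‖ :=
      (le_abs_self _).trans ((f.le_of_opNorm_le hf _).trans (one_mul _).le)
    have h2 : g (x - t • y) ≤ ‖x - t • y‖ :=
      (le_abs_self _).trans ((g.le_of_opNorm_le hg _).trans (one_mul _).le)
    rw [map_add, map_smul, hfx, smul_eq_mul] at h1
    rw [map_sub, map_smul, hgx, smul_eq_mul] at h2
    rw [← mul_div_assoc, le_div_iff₀ ht]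
    linarith
  have key' : ∀ y : X, f y - g y ≤ 0 := by
    intro y
    rcases eq_or_ne y 0 with rfl | hy
    · simp
    have hpos : 0 < ‖y‖ := norm_pos_iff.2 hy
    have h := key (‖y‖⁻¹ • y) (by rw [norm_smul, norm_inv, norm_norm, inv_mul_cancel₀ hpos.ne'])
    rw [map_smul, map_smul, ← smul_sub, smul_eq_mul] at h
    by_contra! hc
    exact absurd h (not_le.2 (by positivity))
  ext y
  have h1 := key' y
  have h2 := key' (-y)
  rw [map_neg, map_neg] at h2
  linarith

theorem existsUnique_isNormalizedDual [UniformSmoothSpace X] (x : X) :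
    ∃! f : StrongDual ℝ X, IsNormalizedDual x f := by
  refine existsUnique_of_exists_of_unique (exists_isNormalizedDual x) fun f g hf hg => ?_
  rw [isNormalizedDual_iff] at hf hg
  rcases eq_or_ne x 0 with rfl | hx
  · rw [norm_zero, norm_eq_zero] at hf hg
    rw [hf.1, hg.1]
  have hpos : 0 < ‖x‖ := norm_pos_iff.2 hx
  have aux : ∀ h : StrongDual ℝ X, ‖h‖ = ‖x‖ ∧ h x = ‖x‖ ^ 2 →
      ‖‖x‖⁻¹ • h‖ ≤ 1 ∧ (‖x‖⁻¹ • h) (‖x‖⁻¹ • x) = 1 := by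
    rintro h ⟨h1, h2⟩
    refine ⟨by rw [norm_smul, h1, norm_inv, norm_norm, inv_mul_cancel₀ hpos.ne'], ?_⟩
    rw [smul_apply, map_smul, h2, smul_eq_mul, smul_eq_mul]
    field_simp
  have h := eq_of_norm_le_one_of_apply_eq_one
    (by rw [norm_smul, norm_inv, norm_norm, inv_mul_cancel₀ hpos.ne'])
    (aux f hf).1 (aux g hg).1 (aux f hf).2 (aux g hg).2
  exact smul_right_injective _ (inv_ne_zero hpos.ne') h

/-- In a uniformly convex space, `‖·‖ ^ 2` is uniformly convex on bounded sets. -/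
theorem exists_forall_sq_norm_midpoint_le [UniformConvexSpace X] {R ε : ℝ} (hR : 0 < R)
    (hε : 0 < ε) :
    ∃ δ > 0, ∀ x y : X, ‖x‖ ≤ R → ‖y‖ ≤ R → ε ≤ ‖x - y‖ →
      ‖(1 / 2 : ℝ) • (x + y)‖ ^ 2 ≤ (‖x‖ ^ 2 + ‖y‖ ^ 2) / 2 - δ := by
  obtain ⟨δ, hδ, H⟩ := exists_forall_closed_ball_dist_add_le_two_sub X (div_pos hε hR)
  -- If the norms differ by at least `η`, convexity of the scalar square gains `η² / 4`. Otherwise,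
  -- dividing by `‖y‖ ≥ ε / 2`, uniform convexity gains `δ ε² / 8`; this `η` keeps the loss from
  -- unequal norms at half of that.
  set η := δ * ε ^ 2 / (16 * R) with hη
  have hηpos : 0 < η := by positivity
  have main : ∀ x y : X, ‖x‖ ≤ ‖y‖ → ‖y‖ ≤ R → ε ≤ ‖x - y‖ →
      ‖(1 / 2 : ℝ) • (x + y)‖ ^ 2 ≤
        (‖x‖ ^ 2 + ‖y‖ ^ 2) / 2 - min (η ^ 2 / 4) (δ * ε ^ 2 / 16) := by
    intro x y hxy hyR hd
    have hn : ‖(1 / 2 : ℝ) • (x + y)‖ = ‖x + y‖ / 2 := by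
      rw [norm_smul]; norm_num; ring
    rw [hn]
    rcases le_total η (‖y‖ - ‖x‖) with h | h
    · have h1 := norm_add_le x y
      have h2 : min (η ^ 2 / 4) (δ * ε ^ 2 / 16) ≤ η ^ 2 / 4 := min_le_left _ _
      have h3 : η ^ 2 ≤ (‖y‖ - ‖x‖) ^ 2 := by gcongr
      have h4 : ‖x + y‖ ^ 2 ≤ (‖x‖ + ‖y‖) ^ 2 := by gcongr
      nlinarith
    · have h2 : min (η ^ 2 / 4) (δ * ε ^ 2 / 16) ≤ δ * ε ^ 2 / 16 := min_le_right _ _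
      have hb : ε / 2 ≤ ‖y‖ := by linarith [norm_sub_le x y]
      have hpos : 0 < ‖y‖ := by linarith
      have hnorm : ∀ z : X, ‖‖y‖⁻¹ • z‖ = ‖z‖ / ‖y‖ := fun z => by
        rw [norm_smul, norm_inv, norm_norm, div_eq_inv_mul]
      have h1 := @H (‖y‖⁻¹ • x) (by rw [hnorm, div_le_one hpos]; exact hxy) (‖y‖⁻¹ • y)
        (by rw [hnorm, div_le_one hpos])
        (by rw [← smul_sub, hnorm]; exact div_le_div₀ (norm_nonneg _) hd hpos hyR)
      rw [← smul_add, hnorm, div_le_iff₀ hpos] at h1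
      have h0 := norm_nonneg (x + y)
      have h3 : (‖x + y‖ / 2) ^ 2 ≤ ‖y‖ ^ 2 - δ * ε ^ 2 / 8 := by
        have h5 : ‖x + y‖ / 2 ≤ ‖y‖ := by linarith [norm_add_le x y]
        have h6 : (‖x + y‖ / 2) ^ 2 ≤ (‖y‖ - δ * ‖y‖ / 2) * ‖y‖ := by
          rw [sq]
          exact mul_le_mul (by linarith) h5 (by positivity) (by linarith)
        have h7 : (ε / 2) ^ 2 ≤ ‖y‖ ^ 2 := by gcongr
        nlinarith
      have h4 : ‖y‖ ^ 2 - ‖x‖ ^ 2 ≤ δ * ε ^ 2 / 8 := by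
        have : ‖y‖ ^ 2 - ‖x‖ ^ 2 ≤ η * (2 * R) := by
          rw [show ‖y‖ ^ 2 - ‖x‖ ^ 2 = (‖y‖ - ‖x‖) * (‖y‖ + ‖x‖) by ring]
          exact mul_le_mul h (by linarith) (by positivity) hηpos.le
        calc _ ≤ η * (2 * R) := this
          _ = δ * ε ^ 2 / 8 := by rw [hη]; field_simp; ring
      linarith
  refine ⟨min (η ^ 2 / 4) (δ * ε ^ 2 / 16), lt_min (by positivity) (by positivity), ?_⟩
  intro x y hx hy hd
  rcases le_total ‖x‖ ‖y‖ with h | h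
  · exact main x y h hy hd
  · have := main y x h hx (by rwa [norm_sub_rev])
    rwa [add_comm y x, add_comm (‖y‖ ^ 2)] at this

/-- Near-minimizers of the Lyapunov function on a convex set are close to each other. -/
theorem exists_forall_dist_lt_of_lyapunov_le [UniformConvexSpace X] {C : Set X}
    (hC : Convex ℝ C) (ψ : StrongDual ℝ X) {m : ℝ} (hm : ∀ z ∈ C, m ≤ lyapunov ψ z) {ε : ℝ}
    (hε : 0 < ε) :
    ∃ η > 0, ∀ x ∈ C, ∀ y ∈ C, lyapunov ψ x ≤ m + η → lyapunov ψ y ≤ m + η → ‖x - y‖ < ε := by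
  set R := ‖ψ‖ + (|m| + 1) + 1 with hR
  obtain ⟨δ, hδ, H⟩ := exists_forall_sq_norm_midpoint_le (X := X) (R := R) (by positivity) hε
  have hbd : ∀ x : X, lyapunov ψ x ≤ m + min 1 (δ / 2) → ‖x‖ ≤ R := by
    intro x hx
    have h1 := (sq_norm_sub_norm_le_lyapunov ψ x).trans hx
    have h2 : min 1 (δ / 2) ≤ 1 := min_le_left _ _
    have h3 := le_abs_self m
    have h4 := abs_nonneg m
    by_contra! hc
    nlinarith
  refine ⟨min 1 (δ / 2), lt_min one_pos (by positivity), fun x hx y hy hx' hy' => ?_⟩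
  by_contra! hc
  -- The remaining terms of `V` are affine, so the midpoint would have `V ≤ m + δ / 2 - δ < m`.
  have h1 := H x y (hbd x hx') (hbd y hy') hc
  have h2 := hm ((1 / 2 : ℝ) • (x + y)) (by
    rw [smul_add]
    exact hC hx hy (by norm_num) (by norm_num) (by norm_num))
  have h3 : min 1 (δ / 2) ≤ δ / 2 := min_le_right _ _
  unfold lyapunov at hx' hy' h2
  rw [map_smul, map_add, smul_eq_mul] at h2
  linarith

theorem existsUnique_isGenProj [CompleteSpace X] [UniformConvexSpace X] {C : Set X}
    (hne : C.Nonempty) (hcl : IsClosed C) (hC : Convex ℝ C) (ψ : StrongDual ℝ X) :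
    ∃! z : X, IsGenProj C ψ z := by
  have hbdd : BddBelow (lyapunov ψ '' C) := ⟨0, by rintro _ ⟨z, -, rfl⟩; exact lyapunov_nonneg ψ z⟩
  set m := sInf (lyapunov ψ '' C)
  have hm : ∀ z ∈ C, m ≤ lyapunov ψ z := fun z hz => csInf_le hbdd ⟨z, hz, rfl⟩
  have hex : ∀ n : ℕ, ∃ z ∈ C, lyapunov ψ z < m + 1 / ((n : ℝ) + 1) := by
    intro n
    obtain ⟨_, ⟨z, hz, rfl⟩, h⟩ := exists_lt_of_csInf_lt (hne.image (lyapunov ψ))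
      (lt_add_of_pos_right m (Nat.one_div_pos_of_nat (α := ℝ) (n := n)))
    exact ⟨z, hz, h⟩
  choose u huC hu using hex
  have hlim : Filter.Tendsto (fun n : ℕ => m + 1 / ((n : ℝ) + 1)) Filter.atTop (𝓝 m) := by
    simpa using tendsto_one_div_add_atTop_nhds_zero_nat.const_add m
  have hcau : CauchySeq u := by
    rw [Metric.cauchySeq_iff]
    intro ε hε
    obtain ⟨η, hη, H⟩ := exists_forall_dist_lt_of_lyapunov_le hC ψ hm hε
    obtain ⟨N, hN⟩ := Filter.eventually_atTop.1
      (hlim.eventually_lt_const (lt_add_of_pos_right m hη))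
    refine ⟨N, fun i hi j hj => ?_⟩
    rw [dist_eq_norm]
    exact H _ (huC i) _ (huC j) ((hu i).trans (hN i hi)).le ((hu j).trans (hN j hj)).le
  obtain ⟨z, hz⟩ := cauchySeq_tendsto_of_complete hcau
  have hzC : z ∈ C := hcl.mem_of_tendsto hz (Filter.Eventually.of_forall huC)
  have hzm : lyapunov ψ z ≤ m :=
    le_of_tendsto_of_tendsto' (((continuous_lyapunov ψ).tendsto z).comp hz) hlim
      fun n => (hu n).le
  refine ⟨z, ⟨hzC, fun w hw => hzm.trans (hm w hw)⟩, fun w hw => ?_⟩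
  by_contra hne
  obtain ⟨η, hη, H⟩ := exists_forall_dist_lt_of_lyapunov_le hC ψ hm
    (norm_pos_iff.2 (sub_ne_zero.2 hne))
  exact lt_irrefl _ (H w hw.1 z hzC (by linarith [isMinOn_iff.1 hw.2 z hzC]) (by linarith))

/-- The infimum of `V(ψ, ·)` over all of `X` is zero, so its unique minimizer is the unique zero;
this yields `J_{X*} ψ` in `X` itself, without invoking reflexivity. -/
theorem existsUnique_isPredualNormalizedDual [CompleteSpace X] [UniformConvexSpace X]
    (ψ : StrongDual ℝ X) : ∃! x : X, IsPredualNormalizedDual ψ x := by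
  obtain ⟨z, ⟨-, hz⟩, huniq⟩ :=
    existsUnique_isGenProj (X := X) Set.univ_nonempty isClosed_univ convex_univ ψ
  have hz0 : lyapunov ψ z = 0 := by
    refine le_antisymm (le_of_forall_pos_lt_add fun ε hε => ?_) (lyapunov_nonneg ψ z)
    obtain ⟨x, hx⟩ := exists_lyapunov_lt ψ hε
    linarith [isMinOn_iff.1 hz x (Set.mem_univ x)]
  refine ⟨z, isPredualNormalizedDual_iff.2 (lyapunov_eq_zero_iff.1 hz0), fun w hw => ?_⟩
  refine huniq w ⟨Set.mem_univ w, fun v _ => ?_⟩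
  have h : lyapunov ψ w = 0 := lyapunov_eq_zero_iff.2 (isPredualNormalizedDual_iff.1 hw)
  exact h.le.trans (lyapunov_nonneg ψ v)

theorem isNormalizedDual_dualityMap (x : X) : IsNormalizedDual x (dualityMap x) :=
  Classical.epsilon_spec (exists_isNormalizedDual x)

theorem IsNormalizedDual.dualityMap_eq [UniformSmoothSpace X] {x : X} {f : StrongDual ℝ X}
    (h : IsNormalizedDual x f) : dualityMap x = f :=
  (existsUnique_isNormalizedDual x).unique (isNormalizedDual_dualityMap x) h

theorem IsNormalizedDual.dualityMapDual_eq [CompleteSpace X] [UniformConvexSpace X] {x : X}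
    {f : StrongDual ℝ X} (h : IsNormalizedDual x f) : dualityMapDual f = x :=
  (existsUnique_isPredualNormalizedDual f).unique
    (Classical.epsilon_spec (existsUnique_isPredualNormalizedDual f).exists)
    (isPredualNormalizedDual_iff.2 h)

theorem isNormalizedDual_dualityMapDual [CompleteSpace X] [UniformConvexSpace X]
    (ψ : StrongDual ℝ X) : IsNormalizedDual (dualityMapDual ψ) ψ :=
  isPredualNormalizedDual_iff.1
    (Classical.epsilon_spec (existsUnique_isPredualNormalizedDual ψ).exists)

theorem genMetricProjFiber_eq_image [CompleteSpace X] [UniformConvexSpace X]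
    [UniformSmoothSpace X] (C : Set X) (y : X) :
    genMetricProjFiber C y = dualityMapDual '' genProjFiber C y := by
  ext u
  constructor
  · intro hu
    exact ⟨dualityMap u, hu, (isNormalizedDual_dualityMap u).dualityMapDual_eq⟩
  · rintro ⟨φ, hφ, rfl⟩
    change genProj C (dualityMap (dualityMapDual φ)) = y
    rw [(isNormalizedDual_dualityMapDual φ).dualityMap_eq]
    exact hφ

theorem genProj_eq_iff [CompleteSpace X] [UniformConvexSpace X] {C : Set X}
    (hne : C.Nonempty) (hcl : IsClosed C) (hC : Convex ℝ C) {ψ : StrongDual ℝ X} {y : X} :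
    genProj C ψ = y ↔ IsGenProj C ψ y := by
  have h := existsUnique_isGenProj hne hcl hC ψ
  have hs : IsGenProj C ψ (genProj C ψ) := Classical.epsilon_spec h.exists
  exact ⟨fun e => e ▸ hs, fun e => h.unique hs e⟩

/-- The generalized projection on a segment `[0, y]` with `‖y‖ = 1` takes the value `y` exactly
on the half-space `{ψ | 1 ≤ ψ y}`. -/
theorem isGenProj_segment_iff {y : X} (hy : ‖y‖ = 1) {ψ : StrongDual ℝ X} :
    IsGenProj {z | ∃ t : ℝ, 0 ≤ t ∧ t ≤ 1 ∧ z = t • y} ψ y ↔ 1 ≤ ψ y := by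
  have hV : ∀ t : ℝ, lyapunov ψ (t • y) = ‖ψ‖ ^ 2 - 2 * (t * ψ y) + t ^ 2 := fun t => by
    rw [lyapunov, map_smul, norm_smul, hy, mul_one, smul_eq_mul, Real.norm_eq_abs, sq_abs]
  have hV1 := hV 1
  rw [one_smul] at hV1
  constructor
  · rintro ⟨-, hmin⟩
    by_contra! hc
    -- On the segment `V` is `t² - 2 t ψ(y)` plus a constant, minimized at `ψ(y)` clamped to `[0,
    -- 1]`.
    set t := max (ψ y) 0 with ht
    have ht0 : 0 ≤ t := le_max_right _ _
    have ht1 : t < 1 := max_lt hc one_pos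
    have hty : ψ y ≤ t := le_max_left _ _
    have h := isMinOn_iff.1 hmin (t • y) ⟨t, ht0, ht1.le, rfl⟩
    rw [hV, hV1] at h
    nlinarith
  · intro h
    refine ⟨⟨1, zero_le_one, le_rfl, (one_smul ℝ y).symm⟩, isMinOn_iff.2 ?_⟩
    rintro _ ⟨t, ht0, ht1, rfl⟩
    rw [hV, hV1]
    nlinarith

end DualityMaps

/-! ### The fibre in coordinates has no vertex. -/

section ConeEquations

/-- The form `a|a| + b|b| + c|c|`. -/
def signedSquareSum (a b c : ℝ) : ℝ := a * |a| + b * |b| + c * |c|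

/-- The form `|a|³ + |b|³ + |c|³`. -/
def absCubeSum (a b c : ℝ) : ℝ := |a| ^ 3 + |b| ^ 3 + |c| ^ 3

/-- The coordinate description of the fibre over `diagPoint`. -/
def InFiber (a b c : ℝ) : Prop :=
  0 < signedSquareSum a b c ∧ 3 * absCubeSum a b c ≤ signedSquareSum a b c ^ 3

theorem signedSquareSum_smul {s : ℝ} (hs : 0 ≤ s) (a b c : ℝ) :
    signedSquareSum (s * a) (s * b) (s * c) = s ^ 2 * signedSquareSum a b c := by
  simp only [signedSquareSum, abs_mul, abs_of_nonneg hs]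
  ring

theorem absCubeSum_smul {s : ℝ} (hs : 0 ≤ s) (a b c : ℝ) :
    absCubeSum (s * a) (s * b) (s * c) = s ^ 3 * absCubeSum a b c := by
  simp only [absCubeSum, abs_mul, abs_of_nonneg hs]
  ring

theorem signedSquareSum_rotate (a b c : ℝ) : signedSquareSum b c a = signedSquareSum a b c := by
  unfold signedSquareSum; ring

theorem absCubeSum_rotate (a b c : ℝ) : absCubeSum b c a = absCubeSum a b c := by
  unfold absCubeSum; ring

theorem inFiber_rotate {a b c : ℝ} : InFiber b c a ↔ InFiber a b c := by
  rw [InFiber, InFiber, signedSquareSum_rotate, absCubeSum_rotate]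

/-- The coordinate form of `IsConeAt`. -/
def IsFiberCone (p q r : ℝ) : Prop :=
  ∀ a b c, InFiber a b c → ∀ t : ℝ, 0 ≤ t →
    InFiber (p + t * (a - p)) (q + t * (b - q)) (r + t * (c - r))

theorem IsFiberCone.rotate {p q r : ℝ} (H : IsFiberCone p q r) : IsFiberCone q r p :=
  fun a b c h t ht => inFiber_rotate.2 (H c a b (inFiber_rotate.1 h) t ht)

theorem continuous_signedSquareSum {f g h : ℝ → ℝ} (hf : Continuous f) (hg : Continuous g)
    (hh : Continuous h) : Continuous fun t => signedSquareSum (f t) (g t) (h t) := by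
  unfold signedSquareSum
  fun_prop

theorem continuous_absCubeSum {f g h : ℝ → ℝ} (hf : Continuous f) (hg : Continuous g)
    (hh : Continuous h) : Continuous fun t => absCubeSum (f t) (g t) (h t) := by
  unfold absCubeSum
  fun_prop

/-- A nonstrict inequality between continuous functions passes to the right limit at zero. -/
theorem le_of_eventually_nhdsGT_zero {f g : ℝ → ℝ} (hf : Continuous f) (hg : Continuous g)
    (h : ∀ᶠ e in 𝓝[>] (0 : ℝ), f e ≤ g e) : f 0 ≤ g 0 :=
  le_of_tendsto_of_tendsto (hf.continuousWithinAt (s := Set.Ioi 0) (x := 0)).tendsto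
    (hg.continuousWithinAt (s := Set.Ioi 0) (x := 0)).tendsto h

theorem eventually_nhdsGT_zero_lt {f g : ℝ → ℝ} (hf : Continuous f) (hg : Continuous g)
    (h : f 0 < g 0) : ∀ᶠ e in 𝓝[>] (0 : ℝ), f e < g e :=
  (hf.continuousAt.eventually_lt hg.continuousAt h).filter_mono nhdsWithin_le_nhds

/-- `Q³` has degree 6 and `S` degree 3, so large multiples of a point with `Q > 0` lie in the fibre.
Contracting the multiple by `e⁻¹` towards the vertex with ratio `e`, and letting `e → 0`, leaves the
translate by the vertex. -/
theorem IsFiberCone.add_mem {p q r : ℝ} (H : IsFiberCone p q r) {a b c : ℝ}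
    (h : 0 < signedSquareSum a b c) :
    3 * absCubeSum (p + a) (q + b) (r + c) ≤ signedSquareSum (p + a) (q + b) (r + c) ^ 3 := by
  have key := le_of_eventually_nhdsGT_zero
    (f := fun e => 3 * absCubeSum (p + (a - e * p)) (q + (b - e * q)) (r + (c - e * r)))
    (g := fun e => signedSquareSum (p + (a - e * p)) (q + (b - e * q)) (r + (c - e * r)) ^ 3)
    ((continuous_absCubeSum (by fun_prop) (by fun_prop) (by fun_prop)).const_mul 3)
    ((continuous_signedSquareSum (by fun_prop) (by fun_prop) (by fun_prop)).pow 3) ?_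
  · simpa using key
  filter_upwards [self_mem_nhdsWithin, eventually_nhdsGT_zero_lt
    (f := fun e => 3 * absCubeSum a b c * e ^ 3) (g := fun _ => signedSquareSum a b c ^ 3)
    (by fun_prop) (by fun_prop) (by simpa using pow_pos h 3)] with e (he : 0 < e) hlt
  have hi : 0 ≤ e⁻¹ := by positivity
  have hmem : InFiber (e⁻¹ * a) (e⁻¹ * b) (e⁻¹ * c) := by
    rw [InFiber, signedSquareSum_smul hi, absCubeSum_smul hi]
    refine ⟨by positivity, ?_⟩
    calc 3 * (e⁻¹ ^ 3 * absCubeSum a b c)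
        = e⁻¹ ^ 6 * (3 * absCubeSum a b c * e ^ 3) := by field_simp
      _ ≤ e⁻¹ ^ 6 * signedSquareSum a b c ^ 3 := by gcongr
      _ = _ := by ring
  have := (H _ _ _ hmem e he.le).2
  simpa only [mul_sub, mul_inv_cancel_left₀ he.ne'] using this

/-- Translates by `s (1, -1, 0)`, where `Q = 0`, are reached as limits. As `s → ∞`, `S ~ 2s³` and `Q
~ 2s(p + q)`, so `6 ≤ 8 (p + q)³`, while `(9/5)³ < 6`. -/
theorem IsFiberCone.lt_add {p q r : ℝ} (H : IsFiberCone p q r) : 9 / 10 < p + q := by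
  have h1 : ∀ s : ℝ, 0 < s →
      3 * absCubeSum (p + s) (q + -s) (r + 0) ≤
        signedSquareSum (p + s) (q + -s) (r + 0) ^ 3 := by
    intro s hs
    have key := le_of_eventually_nhdsGT_zero
      (f := fun e => 3 * absCubeSum (p + (s + e)) (q + -s) (r + 0))
      (g := fun e => signedSquareSum (p + (s + e)) (q + -s) (r + 0) ^ 3)
      ((continuous_absCubeSum (by fun_prop) (by fun_prop) (by fun_prop)).const_mul 3)
      ((continuous_signedSquareSum (by fun_prop) (by fun_prop) (by fun_prop)).pow 3) ?_
    · simpa using key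
    filter_upwards [self_mem_nhdsWithin] with e (he : 0 < e)
    refine H.add_mem ?_
    rw [signedSquareSum, abs_neg, abs_of_pos hs, abs_of_pos (by positivity : 0 < s + e)]
    nlinarith
  -- The limit `s → ∞` is taken with `s = e⁻¹`, after multiplying by `e³`.
  have key := le_of_eventually_nhdsGT_zero
    (f := fun e => 3 * ((1 + e * p) ^ 3 + (1 - e * q) ^ 3))
    (g := fun e => (2 * (p + q) + e * (p ^ 2 - q ^ 2 + r * |r|)) ^ 3)
    (by fun_prop) (by fun_prop) ?_
  · norm_num at key
    by_contra! hc
    have h2 : (2 * (p + q)) ^ 3 ≤ (9 / 5) ^ 3 :=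
      (Odd.strictMono_pow (by decide : Odd 3)).monotone (by linarith)
    norm_num at h2
    linarith
  filter_upwards [self_mem_nhdsWithin,
    eventually_nhdsGT_zero_lt (f := fun _ => 0) (g := fun e => 1 + e * p)
      (by fun_prop) (by fun_prop) (by simp),
    eventually_nhdsGT_zero_lt (f := fun _ => 0) (g := fun e => 1 - e * q)
      (by fun_prop) (by fun_prop) (by simp)] with e (he : 0 < e) hp hq
  have h := h1 e⁻¹ (by positivity)
  have hp' : 0 < p + e⁻¹ := by
    have := mul_pos (inv_pos.2 he) hp
    rwa [mul_add, mul_one, inv_mul_cancel_left₀ he.ne', add_comm] at this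
  have hq' : q + -e⁻¹ < 0 := by
    have := mul_pos (inv_pos.2 he) hq
    rw [mul_sub, mul_one, inv_mul_cancel_left₀ he.ne'] at this
    linarith
  rw [absCubeSum, signedSquareSum, abs_of_pos hp', abs_of_neg hq', add_zero] at h
  have hr : 0 ≤ |r| ^ 3 := by positivity
  calc 3 * ((1 + e * p) ^ 3 + (1 - e * q) ^ 3)
      = e ^ 3 * (3 * ((p + e⁻¹) ^ 3 + (-(q + -e⁻¹)) ^ 3 + 0)) := by field_simp; ring
    _ ≤ e ^ 3 * (3 * ((p + e⁻¹) ^ 3 + (-(q + -e⁻¹)) ^ 3 + |r| ^ 3)) := by gcongr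
    _ ≤ e ^ 3 * ((p + e⁻¹) * (p + e⁻¹) + (q + -e⁻¹) * -(q + -e⁻¹) + r * |r|) ^ 3 := by gcongr
    _ = _ := by
      rw [← mul_pow]
      congr 1
      field_simp
      ring

/-- The ray from the vertex through a fibre point keeps `Q > 0`; by homogeneity its direction has `Q
≥ 0`. -/
theorem IsFiberCone.signedSquareSum_sub_nonneg {p q r : ℝ} (H : IsFiberCone p q r) {a b c : ℝ}
    (h : InFiber a b c) : 0 ≤ signedSquareSum (a - p) (b - q) (c - r) := by
  have key := le_of_eventually_nhdsGT_zero (f := fun _ => 0)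
    (g := fun e => signedSquareSum (e * p + (a - p)) (e * q + (b - q)) (e * r + (c - r)))
    (by fun_prop) (continuous_signedSquareSum (by fun_prop) (by fun_prop) (by fun_prop)) ?_
  · simpa using key
  filter_upwards [self_mem_nhdsWithin] with e (he : 0 < e)
  have h1 := (H a b c h e⁻¹ (by positivity)).1
  have h2 : 0 < e ^ 2 * signedSquareSum (p + e⁻¹ * (a - p)) (q + e⁻¹ * (b - q))
    (r + e⁻¹ * (c - r)) := by positivity
  rw [← signedSquareSum_smul he.le] at h2
  simp only [mul_add, mul_inv_cancel_left₀ he.ne'] at h2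
  exact h2.le

/-- Because `5² = 3² + 4²`, the point `(5s + 1, -3s, -4s)` has `Q` only linear in `s`, yet it lies
in the fibre: `3 · 216 < 10³` compares the leading terms. Subtracting the vertex and letting `s → ∞`
isolates the linear coefficient `10(1 - p) - 6q - 8r`. -/
theorem IsFiberCone.add_le {p q r : ℝ} (H : IsFiberCone p q r) :
    5 * p + 3 * q + 4 * r ≤ 5 := by
  have h1 : ∀ s : ℝ, 1 ≤ s →
      0 ≤ signedSquareSum (5 * s + 1 - p) (-(3 * s) - q) (-(4 * s) - r) := by
    intro s hs
    refine H.signedSquareSum_sub_nonneg ?_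
    have hQ : signedSquareSum (5 * s + 1) (-(3 * s)) (-(4 * s)) = 10 * s + 1 := by
      rw [signedSquareSum, abs_neg, abs_neg, abs_of_pos, abs_of_pos, abs_of_pos]
      · ring
      all_goals linarith
    have hS : absCubeSum (5 * s + 1) (-(3 * s)) (-(4 * s)) =
        216 * s ^ 3 + 75 * s ^ 2 + 15 * s + 1 := by
      rw [absCubeSum, abs_neg, abs_neg, abs_of_pos, abs_of_pos, abs_of_pos]
      · ring
      all_goals linarith
    rw [InFiber, hQ, hS]
    refine ⟨by linarith, ?_⟩
    have h2 : s ≤ s ^ 2 := by nlinarith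
    have h3 : s ^ 2 ≤ s ^ 3 := by nlinarith [sq_nonneg s]
    nlinarith
  have key := le_of_eventually_nhdsGT_zero (f := fun _ => 0)
    (g := fun e => (10 * (1 - p) - 6 * q - 8 * r) + e * ((1 - p) ^ 2 - q ^ 2 - r ^ 2))
    (by fun_prop) (by fun_prop) ?_
  · norm_num at key
    linarith
  filter_upwards [self_mem_nhdsWithin,
    eventually_nhdsGT_zero_lt (f := fun e => e) (g := fun _ => 1)
      (by fun_prop) (by fun_prop) (by simp),
    eventually_nhdsGT_zero_lt (f := fun _ => 0) (g := fun e => 5 + e * (1 - p))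
      (by fun_prop) (by fun_prop) (by simp),
    eventually_nhdsGT_zero_lt (f := fun _ => 0) (g := fun e => 3 + e * q)
      (by fun_prop) (by fun_prop) (by simp),
    eventually_nhdsGT_zero_lt (f := fun _ => 0) (g := fun e => 4 + e * r)
      (by fun_prop) (by fun_prop) (by simp)] with e (he : 0 < e) he1 hp hq hr
  have h := mul_nonneg (sq_nonneg e) (h1 e⁻¹ (one_le_inv₀ he |>.2 he1.le))
  have hx : e * (5 * e⁻¹ + 1 - p) = 5 + e * (1 - p) := by field_simp; ring
  have hy : e * (-(3 * e⁻¹) - q) = -(3 + e * q) := by field_simp; ring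
  have hz : e * (-(4 * e⁻¹) - r) = -(4 + e * r) := by field_simp; ring
  rw [← signedSquareSum_smul he.le, hx, hy, hz, signedSquareSum, abs_neg, abs_neg, abs_of_pos hp,
    abs_of_pos hq, abs_of_pos hr] at h
  by_contra! hc
  nlinarith

theorem not_isFiberCone (p q r : ℝ) : ¬ IsFiberCone p q r := by
  intro H
  have H' := H.rotate
  have H'' := H'.rotate
  -- The sums give `p + q + r > 1.35` and `p + q + r ≤ 1.25`.
  linarith [H.lt_add, H'.lt_add, H''.lt_add, H.add_le, H'.add_le, H''.add_le]

end ConeEquations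

/-! ### The cubic norm on `ℝ³` and the counterexample. -/

section CubeNorm

theorem norm_pow_three (z : R3) : ‖z‖ ^ 3 = absCubeSum (z 0) (z 1) (z 2) := by
  have h3 : (3 : ℝ≥0∞).toReal = 3 := by norm_num
  rw [PiLp.norm_eq_sum (by rw [h3]; norm_num), h3, ← Real.rpow_natCast, ← Real.rpow_mul]
  · norm_num [Fin.sum_univ_three, absCubeSum]
  · positivity

/-- Clarkson's inequality for exponent 3: for `0 ≤ b ≤ a` the difference is `2 (a - b)² (a + 2b)`.
-/
theorem abs_add_pow_three_add_le (a b : ℝ) :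
    |a + b| ^ 3 + |a - b| ^ 3 ≤ 4 * (|a| ^ 3 + |b| ^ 3) := by
  have main : ∀ a b : ℝ, 0 ≤ b → b ≤ a →
      |a + b| ^ 3 + |a - b| ^ 3 ≤ 4 * (|a| ^ 3 + |b| ^ 3) := by
    intro a b hb hab
    rw [abs_of_nonneg hb, abs_of_nonneg (hb.trans hab), abs_of_nonneg (sub_nonneg.2 hab),
      abs_of_nonneg (by linarith : 0 ≤ a + b)]
    nlinarith [mul_nonneg (sq_nonneg (a - b)) (by linarith : 0 ≤ a + 2 * b)]
  have main' : ∀ a b : ℝ, 0 ≤ a → 0 ≤ b →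
      |a + b| ^ 3 + |a - b| ^ 3 ≤ 4 * (|a| ^ 3 + |b| ^ 3) := by
    intro a b ha hb
    rcases le_total b a with h | h
    · exact main a b hb h
    · have := main b a ha h
      rwa [add_comm b a, abs_sub_comm, add_comm (|b| ^ 3)] at this
  rcases le_total 0 a with ha | ha <;> rcases le_total 0 b with hb | hb
  · exact main' a b ha hb
  · have := main' a (-b) ha (by linarith)
    rwa [sub_neg_eq_add, ← sub_eq_add_neg, abs_neg, add_comm (|a - b| ^ 3)] at this
  · have := main' (-a) b (by linarith) hb
    rwa [abs_neg, neg_add_eq_sub, abs_sub_comm, ← neg_add', abs_neg,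
      add_comm (|a - b| ^ 3)] at this
  · have := main' (-a) (-b) (by linarith) (by linarith)
    rwa [abs_neg, abs_neg, ← neg_add, abs_neg, ← neg_sub', abs_neg] at this

/-- There is no term linear in `b`, which makes the modulus of smoothness `O(t²)`. -/
theorem abs_add_pow_three_add_le' (a b : ℝ) :
    |a + b| ^ 3 + |a - b| ^ 3 ≤ 2 * |a| ^ 3 + 6 * |a| * |b| ^ 2 + 2 * |b| ^ 3 := by
  have main : ∀ a b : ℝ, 0 ≤ a → 0 ≤ b →
      |a + b| ^ 3 + |a - b| ^ 3 ≤ 2 * |a| ^ 3 + 6 * |a| * |b| ^ 2 + 2 * |b| ^ 3 := by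
    intro a b ha hb
    rw [abs_of_nonneg ha, abs_of_nonneg hb, abs_of_nonneg (by linarith : 0 ≤ a + b)]
    rcases le_total b a with h | h
    · rw [abs_of_nonneg (sub_nonneg.2 h)]
      nlinarith [pow_nonneg hb 3]
    · rw [abs_of_nonpos (sub_nonpos.2 h)]
      nlinarith [pow_nonneg ha 3, mul_nonneg (mul_nonneg ha hb) (sub_nonneg.2 h)]
  rcases le_total 0 a with ha | ha <;> rcases le_total 0 b with hb | hb
  · exact main a b ha hb
  · have := main a (-b) ha (by linarith)
    rwa [sub_neg_eq_add, ← sub_eq_add_neg, abs_neg, add_comm (|a - b| ^ 3)] at this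
  · have := main (-a) b (by linarith) hb
    rwa [abs_neg, neg_add_eq_sub, abs_sub_comm, ← neg_add', abs_neg,
      add_comm (|a - b| ^ 3)] at this
  · have := main (-a) (-b) (by linarith) (by linarith)
    rwa [abs_neg, abs_neg, ← neg_add, abs_neg, ← neg_sub', abs_neg] at this

theorem norm_add_pow_three_add_le (x y : R3) :
    ‖x + y‖ ^ 3 + ‖x - y‖ ^ 3 ≤ 4 * (‖x‖ ^ 3 + ‖y‖ ^ 3) := by
  simp only [norm_pow_three, absCubeSum, PiLp.add_apply, PiLp.sub_apply]
  linarith [abs_add_pow_three_add_le (x 0) (y 0), abs_add_pow_three_add_le (x 1) (y 1),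
    abs_add_pow_three_add_le (x 2) (y 2)]

theorem norm_add_pow_three_add_le' {x y : R3} (hx : ‖x‖ = 1) :
    ‖x + y‖ ^ 3 + ‖x - y‖ ^ 3 ≤ 2 + 18 * ‖y‖ ^ 2 + 2 * ‖y‖ ^ 3 := by
  have h1 : ∀ i, |x i| * |y i| ^ 2 ≤ ‖y‖ ^ 2 := fun i => by
    have hxi : |x i| ≤ 1 := hx ▸ PiLp.norm_apply_le x i
    have hyi : |y i| ^ 2 ≤ ‖y‖ ^ 2 := by
      gcongr
      exact PiLp.norm_apply_le y i
    nlinarith [sq_nonneg |y i|]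
  have hx3 := norm_pow_three x
  have hy3 := norm_pow_three y
  rw [hx] at hx3
  simp only [norm_pow_three (x + y), norm_pow_three (x - y), absCubeSum, PiLp.add_apply,
    PiLp.sub_apply] at hx3 hy3 ⊢
  linarith [abs_add_pow_three_add_le' (x 0) (y 0), abs_add_pow_three_add_le' (x 1) (y 1),
    abs_add_pow_three_add_le' (x 2) (y 2), h1 0, h1 1, h1 2]

instance uniformConvexSpace_R3 : UniformConvexSpace R3 where
  uniform_convex ε hε := by
    -- For `u = ‖x + y‖ ≤ 2`, `ε³ ≤ 8 - u³ = (2 - u)(4 + 2u + u²) ≤ 12 (2 - u)`.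
    refine ⟨ε ^ 3 / 12, by positivity, fun x hx y hy hxy => ?_⟩
    have h := norm_add_pow_three_add_le x y
    rw [hx, hy] at h
    have h1 : ε ^ 3 ≤ ‖x - y‖ ^ 3 := by gcongr
    have h2 : ‖x + y‖ ≤ 2 := by linarith [norm_add_le x y]
    have h3 := norm_nonneg (x + y)
    nlinarith [mul_nonneg (sub_nonneg.2 h2) (by nlinarith : 0 ≤ 8 - 2 * ‖x + y‖ - ‖x + y‖ ^ 2)]

instance uniformSmoothSpace_R3 : UniformSmoothSpace R3 where
  tendsto_modulus := by
    have hlim : Filter.Tendsto (fun t : ℝ => 3 * t + t ^ 2) (𝓝[>] 0) (𝓝 0) := by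
      have : Continuous fun t : ℝ => 3 * t + t ^ 2 := by fun_prop
      simpa using (this.continuousWithinAt (s := Set.Ioi 0) (x := 0)).tendsto
    refine tendsto_of_tendsto_of_tendsto_of_le_of_le' tendsto_const_nhds hlim ?_ ?_
    · filter_upwards [self_mem_nhdsWithin] with t (ht : 0 < t)
      refine div_nonneg (Real.sSup_nonneg ?_) ht.le
      rintro _ ⟨x, y, hx, -, rfl⟩
      have h := norm_add_le (x + y) (x - y)
      rw [add_add_sub_cancel, ← two_smul ℝ x, norm_smul, hx] at h
      norm_num at h
      linarith
    · filter_upwards [self_mem_nhdsWithin] with t (ht : 0 < t)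
      rw [div_le_iff₀ ht]
      refine Real.sSup_le ?_ (by positivity)
      rintro _ ⟨x, y, hx, hy, rfl⟩
      have h := norm_add_pow_three_add_le' (y := y) hx
      rw [hy] at h
      -- The tangent line of `A³` at `1` turns the bound on cubes into `ρ(t) ≤ 3t² + t³ / 3`.
      have amgm : ∀ A : ℝ, 0 ≤ A → 3 * A ≤ A ^ 3 + 2 := fun A hA => by
        nlinarith [mul_nonneg (sq_nonneg (A - 1)) (by linarith : 0 ≤ A + 2)]
      nlinarith [amgm _ (norm_nonneg (x + y)), amgm _ (norm_nonneg (x - y)), pow_pos ht 3]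

theorem diagPoint_apply (i : Fin 3) : diagPoint i = (3 : ℝ) ^ (-(1 / 3) : ℝ) := rfl

theorem three_rpow_pow_three : ((3 : ℝ) ^ (-(1 / 3) : ℝ)) ^ 3 = 1 / 3 := by
  rw [← Real.rpow_natCast, ← Real.rpow_mul (by norm_num)]
  norm_num

theorem norm_diagPoint : ‖diagPoint‖ = 1 := by
  have h : ‖diagPoint‖ ^ 3 = 1 := by
    have hpos : 0 < (3 : ℝ) ^ (-(1 / 3) : ℝ) := by positivity
    rw [norm_pow_three, absCubeSum]
    simp only [diagPoint_apply]
    rw [abs_of_pos hpos, three_rpow_pow_three]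
    norm_num
  exact (pow_eq_one_iff_of_nonneg (norm_nonneg _) (by norm_num)).1 h

/-- The functional `z ↦ ∑ xᵢ|xᵢ|zᵢ` on `ℝ³`. -/
def gradientForm (x : R3) : R3 →ₗ[ℝ] ℝ where
  toFun z := x 0 * |x 0| * z 0 + x 1 * |x 1| * z 1 + x 2 * |x 2| * z 2
  map_add' z w := by simp only [PiLp.add_apply]; ring
  map_smul' s z := by simp only [PiLp.smul_apply, smul_eq_mul, RingHom.id_apply]; ring

/-- Hölder's inequality with exponents `3/2` and `3`, from Young's inequality on normalized
coordinates. -/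
theorem abs_gradientForm_le (x z : R3) : |gradientForm x z| ≤ ‖x‖ ^ 2 * ‖z‖ := by
  rcases eq_or_ne x 0 with rfl | hx
  · simp [gradientForm]
  rcases eq_or_ne z 0 with rfl | hz
  · simp
  have hX : 0 < ‖x‖ := norm_pos_iff.2 hx
  have hZ : 0 < ‖z‖ := norm_pos_iff.2 hz
  have young : ∀ i, |x i * |x i| * z i| ≤
      ‖x‖ ^ 2 * ‖z‖ * ((2 * (|x i| ^ 3 / ‖x‖ ^ 3) + |z i| ^ 3 / ‖z‖ ^ 3) / 3) := by
    intro i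
    have h : ∀ α β : ℝ, 0 ≤ α → 0 ≤ β → α ^ 2 * β ≤ (2 * α ^ 3 + β ^ 3) / 3 :=
      fun α β hα hβ => by
        nlinarith [mul_nonneg (sq_nonneg (α - β)) (by linarith : 0 ≤ 2 * α + β)]
    have h1 := h (|x i| / ‖x‖) (|z i| / ‖z‖) (by positivity) (by positivity)
    rw [div_pow, div_pow, div_pow] at h1
    calc |x i * |x i| * z i| = ‖x‖ ^ 2 * ‖z‖ * (|x i| ^ 2 / ‖x‖ ^ 2 * (|z i| / ‖z‖)) := by
          rw [abs_mul, abs_mul, abs_abs]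
          field_simp
      _ ≤ _ := by gcongr
  have hx3 := norm_pow_three x
  have hz3 := norm_pow_three z
  rw [absCubeSum] at hx3 hz3
  calc |gradientForm x z| ≤ _ := abs_add_three _ _ _
    _ ≤ _ := add_le_add (add_le_add (young 0) (young 1)) (young 2)
    _ = ‖x‖ ^ 2 * ‖z‖ * ((2 * ((|x 0| ^ 3 + |x 1| ^ 3 + |x 2| ^ 3) / ‖x‖ ^ 3) +
          (|z 0| ^ 3 + |z 1| ^ 3 + |z 2| ^ 3) / ‖z‖ ^ 3) / 3) := by ring
    _ = ‖x‖ ^ 2 * ‖z‖ := by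
      rw [← hx3, ← hz3, div_self (by positivity), div_self (by positivity)]
      ring

theorem gradientForm_self (x : R3) : gradientForm x x = ‖x‖ ^ 3 := by
  have h : ∀ a : ℝ, a * |a| * a = |a| ^ 3 := fun a => by
    rw [mul_right_comm, ← abs_mul_abs_self a]; ring
  rw [norm_pow_three, absCubeSum, ← h, ← h, ← h]
  rfl

theorem gradientForm_diagPoint (x : R3) : gradientForm x diagPoint =
    (3 : ℝ) ^ (-(1 / 3) : ℝ) * signedSquareSum (x 0) (x 1) (x 2) := by
  change x 0 * |x 0| * diagPoint 0 + x 1 * |x 1| * diagPoint 1 + x 2 * |x 2| * diagPoint 2 = _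
  simp only [diagPoint_apply, signedSquareSum]
  ring

theorem dualityMap_R3_apply {x : R3} (hx : x ≠ 0) (z : R3) :
    dualityMap x z = gradientForm x z / ‖x‖ := by
  have hX : 0 < ‖x‖ := norm_pos_iff.2 hx
  let f : StrongDual ℝ R3 := (‖x‖⁻¹ • gradientForm x).mkContinuous ‖x‖ fun w => by
    rw [LinearMap.smul_apply, norm_smul, norm_inv, norm_norm, inv_mul_le_iff₀ hX]
    calc _ ≤ ‖x‖ ^ 2 * ‖w‖ := abs_gradientForm_le x w
      _ = _ := by ring
  have hf : ∀ w, f w = ‖x‖⁻¹ * gradientForm x w := fun _ => rfl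
  have hfx : f x = ‖x‖ ^ 2 := by
    rw [hf, gradientForm_self]
    field_simp
  have hJ : IsNormalizedDual x f := by
    refine isNormalizedDual_iff.2 ⟨le_antisymm (LinearMap.mkContinuous_norm_le _ hX.le _) ?_, hfx⟩
    have h := (le_abs_self _).trans (f.le_opNorm x)
    rw [hfx, sq] at h
    exact le_of_mul_le_mul_right h hX
  rw [hJ.dualityMap_eq, hf, div_eq_inv_mul]

theorem isClosed_diagSegment : IsClosed diagSegment := by
  have h : diagSegment = (fun t : ℝ => t • diagPoint) '' Set.Icc 0 1 := by
    ext z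
    constructor
    · rintro ⟨t, h0, h1, rfl⟩
      exact ⟨t, ⟨h0, h1⟩, rfl⟩
    · rintro ⟨t, ⟨h0, h1⟩, rfl⟩
      exact ⟨t, h0, h1, rfl⟩
  rw [h]
  exact (isCompact_Icc.image (by fun_prop)).isClosed

theorem convex_diagSegment : Convex ℝ diagSegment := by
  rintro _ ⟨s, hs0, hs1, rfl⟩ _ ⟨t, ht0, ht1, rfl⟩ a b ha hb hab
  refine ⟨a * s + b * t, by positivity, by nlinarith, ?_⟩
  rw [smul_smul, smul_smul, ← add_smul]

theorem diagPoint_mem_diagSegment : diagPoint ∈ diagSegment :=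
  ⟨1, zero_le_one, le_rfl, (one_smul ℝ _).symm⟩

theorem mem_genMetricProjFiber_diagSegment_iff {x : R3} :
    x ∈ genMetricProjFiber diagSegment diagPoint ↔ InFiber (x 0) (x 1) (x 2) := by
  change genProj diagSegment (dualityMap x) = diagPoint ↔ _
  rw [genProj_eq_iff ⟨_, diagPoint_mem_diagSegment⟩ isClosed_diagSegment convex_diagSegment,
    diagSegment, isGenProj_segment_iff norm_diagPoint]
  -- The origin satisfies `3S ≤ Q³`; only `0 < Q` excludes it. For `x ≠ 0` the condition is
  -- `3^(-1/3) Q ≥ ‖x‖`, which is then cubed.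
  rcases eq_or_ne x 0 with rfl | hx
  · have h : dualityMap (0 : R3) = 0 := by
      have := (isNormalizedDual_iff.1 (isNormalizedDual_dualityMap (0 : R3))).1
      rwa [norm_zero, norm_eq_zero] at this
    rw [h]
    norm_num [InFiber, signedSquareSum]
  have hX : 0 < ‖x‖ := norm_pos_iff.2 hx
  have hd : 0 < (3 : ℝ) ^ (-(1 / 3) : ℝ) := by positivity
  rw [dualityMap_R3_apply hx, gradientForm_diagPoint, one_le_div hX, InFiber, ← norm_pow_three,
    ← (Odd.strictMono_pow (by decide : Odd 3)).le_iff_le, mul_pow, three_rpow_pow_three]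
  have h3 : 0 < ‖x‖ ^ 3 := by positivity
  constructor
  · intro h
    have hc : 0 < signedSquareSum (x 0) (x 1) (x 2) ^ 3 := by linarith
    exact ⟨(Odd.pow_pos_iff (by decide : Odd 3)).1 hc, by linarith⟩
  · rintro ⟨-, h⟩
    linarith

theorem mem_genMetricProjFiber_toLp_iff {a b c : ℝ} :
    (WithLp.toLp 3 ![a, b, c] : R3) ∈ genMetricProjFiber diagSegment diagPoint ↔
      InFiber a b c :=
  mem_genMetricProjFiber_diagSegment_iff

theorem exists_ne_genMetricProj_eq_diagPoint :
    ∃ x : R3, x ≠ diagPoint ∧ genMetricProj diagSegment x = diagPoint := by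
  refine ⟨WithLp.toLp 3 ![2, 2, 2], fun h => ?_, mem_genMetricProjFiber_toLp_iff.2 ?_⟩
  · have h0 : (2 : ℝ) = (3 : ℝ) ^ (-(1 / 3) : ℝ) := congrArg (fun z : R3 => z 0) h
    have := three_rpow_pow_three
    rw [← h0] at this
    norm_num at this
  · norm_num [InFiber, signedSquareSum, absCubeSum]

theorem not_convex_genMetricProjFiber :
    ¬ Convex ℝ (genMetricProjFiber diagSegment diagPoint) := by
  intro H
  -- Here `Q = 200` and `3S = 5058000 ≤ 200³`; the midpoint with the permuted point is `(15, 15,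
  -- -70)`, where `Q < 0`.
  have h1 : (WithLp.toLp 3 ![100, -70, -70] : R3) ∈ genMetricProjFiber diagSegment diagPoint :=
    mem_genMetricProjFiber_toLp_iff.2 (by norm_num [InFiber, signedSquareSum, absCubeSum])
  have h2 : (WithLp.toLp 3 ![-70, 100, -70] : R3) ∈ genMetricProjFiber diagSegment diagPoint :=
    mem_genMetricProjFiber_toLp_iff.2 (by norm_num [InFiber, signedSquareSum, absCubeSum])
  have h := mem_genMetricProjFiber_diagSegment_iff.1 (H h1 h2 (by norm_num : (0 : ℝ) ≤ 1 / 2)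
    (by norm_num : (0 : ℝ) ≤ 1 / 2) (by norm_num))
  have h' : InFiber (1 / 2 * 100 + 1 / 2 * -70) (1 / 2 * -70 + 1 / 2 * 100)
      (1 / 2 * -70 + 1 / 2 * -70) := h
  norm_num [InFiber, signedSquareSum, absCubeSum] at h'

theorem not_isConeAt_genMetricProjFiber (p : R3) :
    ¬ IsConeAt (genMetricProjFiber diagSegment diagPoint) p := fun H =>
  not_isFiberCone (p 0) (p 1) (p 2) fun _ _ _ h t ht =>
    mem_genMetricProjFiber_diagSegment_iff.1 (H _ (mem_genMetricProjFiber_toLp_iff.2 h) t ht)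

end CubeNorm

theorem theorem3p5 :
    (∀ (X : Type*) [NormedAddCommGroup X] [NormedSpace ℝ X] [CompleteSpace X]
        [UniformConvexSpace X] [UniformSmoothSpace X] (C : Set X),
      C.Nonempty → IsClosed C → Convex ℝ C →
        -- the maps `J_X`, `J_{X*}` and `π_C` are everywhere defined and single-valued
        (∀ x : X, ∃! f : StrongDual ℝ X, IsNormalizedDual x f) ∧
        (∀ ψ : StrongDual ℝ X, ∃! x : X, IsPredualNormalizedDual ψ x) ∧
        (∀ ψ : StrongDual ℝ X, ∃! z : X, IsGenProj C ψ z) ∧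
        -- the inverse image formula
        ∀ y ∈ C, genMetricProjFiber C y = dualityMapDual '' genProjFiber C y) ∧
    -- the counterexample
    (CompleteSpace R3 ∧ UniformConvexSpace R3 ∧ UniformSmoothSpace R3 ∧
      diagSegment.Nonempty ∧ IsClosed diagSegment ∧ Convex ℝ diagSegment ∧
      diagPoint ∈ diagSegment ∧
      (∃ x : R3, x ≠ diagPoint ∧ genMetricProj diagSegment x = diagPoint) ∧
      ¬ Convex ℝ (genMetricProjFiber diagSegment diagPoint) ∧
      ∀ p : R3, ¬ IsConeAt (genMetricProjFiber diagSegment diagPoint) p) := by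
  refine ⟨?_, inferInstance, inferInstance, inferInstance, ⟨_, diagPoint_mem_diagSegment⟩,
    isClosed_diagSegment, convex_diagSegment, diagPoint_mem_diagSegment,
    exists_ne_genMetricProj_eq_diagPoint, not_convex_genMetricProjFiber,
    not_isConeAt_genMetricProjFiber⟩
  intro X _ _ _ _ _ C hne hcl hC
  exact ⟨existsUnique_isNormalizedDual, existsUnique_isPredualNormalizedDual,
    existsUnique_isGenProj hne hcl hC, fun y _ => genMetricProjFiber_eq_image C y⟩
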